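/- Consider a connected nonlinear circuit with exactly one memristor and finitely many (possibly zero) capacitors, inductors, resistors, and DC voltage and current sources, with subscripts $m,c,l,r,u,j$, respectively. The memristor has a $C^2$ flux-charge relation $\varphi=\phi(q)$ and memristance $M(q)=\phi'(q)$; the capacitance matrix $C(v_c)$ and the inductance matrix $L(i_l)$ depend continuously on their arguments and need be neither diagonal nor symmetric; the resistors have a $C^1$ characteristic $v_r=\gamma(i_r)$, and $R(i_r)=\gamma'(i_r)$. Let $B$ be any reduced loop matrix and $Q$ any reduced cutset matrix of the underlying digraph, split by columns according to the type of the branches. The circuit is modelled by $$q_m'=i_m,\qquad C(v_c)v_c'=i_c,\qquad L(i_l)i_l'=v_l,$$ $$0=B_mM(q_m)i_m+B_cv_c+B_lv_l+B_r\gamma(i_r)+B_uV+B_jv_j,$$ $$0=Q_mi_m+Q_ci_c+Q_li_l+Q_ri_r+Q_ui_u+Q_jI,$$ with constant vectors $V$, $I$. Write $y=(q_m,v_c,i_l)$ and $z=(i_m,i_c,v_l,i_r,v_j,i_u)$, and let $(y^*,z^*)$ be an equilibrium at which $C(v_c^*)$ and $L(i_l^*)$ are non-singular and $R(i_r^*)$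 is diagonal. Near $(y^*,z^*)$ the system has the form $y'=h(y,z)$, $0=g(y,z)$, where $g$ is the right-hand side of the last two equations and $h=(i_m,\,C(v_c)^{-1}i_c,\,L(i_l)^{-1}v_l)$; put $F=(h,g)$. A VC-loop is a loop composed only of voltage sources and/or capacitors; IL-cutsets, VL-loops and IC-cutsets are defined analogously (I: current sources, L: inductors). A proper tree is a spanning tree that contains all voltage sources and capacitors and neither current sources nor inductors; an L-proper tree is a spanning tree that contains all voltage sources and inductors and neither current sources nor capacitors. The MR-product of a spanning tree is the product of the memristance and the resistances, evaluated at the equilibrium, of the memristor and the resistors that do not belong to the tree (equal to $1$ if there are none). Assume that 1. the circuit displays no VC-loops, IL-cutsets, VL-loops or IC-cutsets; 2. the sum of the MR-products over all proper trees does not vanish; 3. the sum of the MR-products over all L-proper trees vanishes. Then the algebraic multiplicity of the zero eigenvalue at $(y^*,z^*)$ is greater than one: the polynomial $\det\left(\lambda\,\mathrm{diag}(I,0)-F'(y^*,z^*)\right)$ is not identically zero and has $\lambda=0$ as a root of multiplicity at least two. No passivity assumption is made. -/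

import Mathlib

/-!
Nonlinear circuits with exactly one memristor, modelled by a semiexplicit differential-algebraic
system on a directed multigraph.
-/

namespace Memristive

/-! ### Directed multigraphs: loops, cutsets, spanning trees, loop and cutset matrices -/

/-- A digraph with node set `V` and edge set `E`; parallel edges are allowed. -/
structure MultiDigraph (V E : Type*) where
  /-- the node at which an edge starts -/
  src : E → V
  /-- the node at which an edge ends -/
  dst : E → V

namespace MultiDigraph

variable {V E : Type*} (G : MultiDigraph V E)

/-- The undirected graph on all the nodes in which two nodes are adjacent if they are joined by an
edge from `S`. It has the connected components of the subgraph with edge set `S`. -/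
def subgraph (S : Set E) : SimpleGraph V where
  Adj a b := a ≠ b ∧ ∃ e ∈ S, (G.src e = a ∧ G.dst e = b) ∨ (G.src e = b ∧ G.dst e = a)
  symm := ⟨fun _ _ h => ⟨h.1.symm, h.2.imp fun _ he => ⟨he.1, he.2.symm⟩⟩⟩

/-- The number of connected components of the subgraph that contains all the nodes and the edges
from `S`. -/
noncomputable def numComponents (S : Set E) : ℕ :=
  Nat.card (G.subgraph S).ConnectedComponent

/-- The digraph is connected (regardless of the orientation of its edges). -/
def IsConnected : Prop := (G.subgraph Set.univ).Connected

/-- `v 0, e 0, v 1, e 1, …, v n, e n, v 0` is a closed walk with pairwise distinct nodes and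
pairwise distinct edges; `s i = 1` if the edge `e i` is traversed in its own direction, and
`s i = -1` if it is traversed in the opposite direction. (Addition in `Fin (n + 1)` is cyclic.) -/
def IsLoopTraversal {n : ℕ} (v : Fin (n + 1) → V) (e : Fin (n + 1) → E)
    (s : Fin (n + 1) → ℝ) : Prop :=
  Function.Injective v ∧ Function.Injective e ∧
    ∀ i, (s i = 1 ∧ G.src (e i) = v i ∧ G.dst (e i) = v (i + 1)) ∨
      (s i = -1 ∧ G.dst (e i) = v i ∧ G.src (e i) = v (i + 1))

/-- `K` is the edge set of a loop. -/
def IsLoop (K : Set E) : Prop :=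
  ∃ (n : ℕ) (v : Fin (n + 1) → V) (e : Fin (n + 1) → E) (s : Fin (n + 1) → ℝ),
    G.IsLoopTraversal v e s ∧ K = Set.range e

/-- `w` is the row of the loop matrix that belongs to some loop with some orientation. -/
def IsLoopVector (w : E → ℝ) : Prop :=
  ∃ (n : ℕ) (v : Fin (n + 1) → V) (e : Fin (n + 1) → E) (s : Fin (n + 1) → ℝ),
    G.IsLoopTraversal v e s ∧ (∀ i, w (e i) = s i) ∧ ∀ b, b ∉ Set.range e → w b = 0

/-- `K` is a cutset: removing `K` increases the number of connected components, and `K` is minimal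
with respect to this property. -/
def IsCutset (K : Set E) : Prop :=
  G.numComponents Set.univ < G.numComponents Kᶜ ∧
    ∀ K', K' ⊂ K → G.numComponents K'ᶜ = G.numComponents Set.univ

/-- `w` is the row of the cutset matrix that belongs to some cutset, oriented from the connected
component `a` towards the connected component `b` of the graph without the cutset. -/
def IsCutsetVector (w : E → ℝ) : Prop :=
  ∃ K, G.IsCutset K ∧ ∃ a b : (G.subgraph Kᶜ).ConnectedComponent, a ≠ b ∧
    (∀ e ∈ K,
      (w e = 1 ∧ (G.subgraph Kᶜ).connectedComponentMk (G.src e) = a ∧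
        (G.subgraph Kᶜ).connectedComponentMk (G.dst e) = b) ∨
      (w e = -1 ∧ (G.subgraph Kᶜ).connectedComponentMk (G.src e) = b ∧
        (G.subgraph Kᶜ).connectedComponentMk (G.dst e) = a)) ∧
    ∀ e, e ∉ K → w e = 0

/-- `B` is a reduced loop matrix: it consists of `m - n + k` linearly independent rows of the loop
matrix, for `m` edges, `n` nodes and `k` connected components. -/
def IsReducedLoopMatrix [Fintype V] [Fintype E] {ι : Type*} [Fintype ι]
    (B : Matrix ι E ℝ) : Prop :=
  (∀ i, G.IsLoopVector (B i)) ∧ LinearIndependent ℝ (fun i => B i) ∧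
    Fintype.card ι + Fintype.card V = Fintype.card E + G.numComponents Set.univ

/-- `Q` is a reduced cutset matrix: it consists of `n - k` linearly independent rows of the cutset
matrix, for `n` nodes and `k` connected components. -/
def IsReducedCutsetMatrix [Fintype V] {κ : Type*} [Fintype κ]
    (Q : Matrix κ E ℝ) : Prop :=
  (∀ i, G.IsCutsetVector (Q i)) ∧ LinearIndependent ℝ (fun i => Q i) ∧
    Fintype.card κ + G.numComponents Set.univ = Fintype.card V

/-- `T` is the edge set of a spanning tree: the subgraph with all the nodes and the edges from `T`
is connected and contains no loop. -/
def IsSpanningTree (T : Set E) : Prop :=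
  (G.subgraph T).Connected ∧ ∀ K ⊆ T, ¬ G.IsLoop K

end MultiDigraph

/-! ### Circuits with a single memristor -/

/-- The branches of a circuit with one memristor, capacitors labelled by `c`, inductors by `l`,
resistors by `r`, voltage sources by `u` and current sources by `j`. -/
inductive Branch (c l r u j : Type*) where
  | mem : Branch c l r u j
  | cap : c → Branch c l r u j
  | ind : l → Branch c l r u j
  | res : r → Branch c l r u j
  | vsrc : u → Branch c l r u j
  | isrc : j → Branch c l r u j
  deriving DecidableEq, Fintype

/-- Labels of the dynamic variables `y = (q_m, v_c, i_l)`. -/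
inductive Dyn (c l : Type*) where
  | charge : Dyn c l
  | vcap : c → Dyn c l
  | iind : l → Dyn c l
  deriving DecidableEq, Fintype

/-- A nonlinear autonomous circuit with a single memristor. -/
structure Circuit (V c l r u j : Type*) [Fintype r] where
  /-- the digraph that underlies the circuit -/
  graph : MultiDigraph V (Branch c l r u j)
  /-- the flux-charge characteristic of the memristor -/
  φ : ℝ → ℝ
  contDiff_φ : ContDiff ℝ 2 φ
  /-- the capacitance matrix as a function of the capacitor voltages -/
  C : (c → ℝ) → Matrix c c ℝ
  continuous_C : Continuous C
  /-- the inductance matrix as a function of the inductor currents -/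
  L : (l → ℝ) → Matrix l l ℝ
  continuous_L : Continuous L
  /-- the current-controlled voltage characteristic of the resistors -/
  γ : (r → ℝ) → (r → ℝ)
  contDiff_γ : ContDiff ℝ 1 γ
  /-- the voltages of the voltage sources -/
  Vs : u → ℝ
  /-- the currents of the current sources -/
  Is : j → ℝ

/-- The index set of the variables `(y, z)`. The variable `z` has one entry for every branch:
`z = (i_m, i_c, v_l, i_r, v_j, i_u)`, that is, the current of the memristor, of the capacitors, of
the resistors and of the voltage sources, and the voltage of the inductors and of the current
sources. -/
abbrev Var (c l r u j : Type*) := Dyn c l ⊕ Branch c l r u j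

section Variables

variable {c l r u j : Type*} (x : Var c l r u j → ℝ)

/-- the charge of the memristor -/
def qm : ℝ := x (.inl .charge)
/-- the voltages of the capacitors -/
def vc : c → ℝ := fun k => x (.inl (.vcap k))
/-- the currents of the inductors -/
def il : l → ℝ := fun k => x (.inl (.iind k))
/-- the current of the memristor -/
def im : ℝ := x (.inr .mem)
/-- the currents of the capacitors -/
def ic : c → ℝ := fun k => x (.inr (.cap k))
/-- the voltages of the inductors -/
def vl : l → ℝ := fun k => x (.inr (.ind k))
/-- the currents of the resistors -/
def ir : r → ℝ := fun k => x (.inr (.res k))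
/-- the voltages of the current sources -/
def vj : j → ℝ := fun k => x (.inr (.isrc k))
/-- the currents of the voltage sources -/
def iu : u → ℝ := fun k => x (.inr (.vsrc k))

end Variables

namespace Circuit

variable {V c l r u j : Type*} [Fintype r] (N : Circuit V c l r u j)

/-- The memristance `M(q) = φ'(q)`. -/
noncomputable def memristance (q : ℝ) : ℝ := deriv N.φ q

/-- The resistance matrix `R(i_r) = γ'(i_r)`. -/
noncomputable def resistance [DecidableEq r] (i : r → ℝ) : Matrix r r ℝ :=
  LinearMap.toMatrix' (fderiv ℝ N.γ i : (r → ℝ) →ₗ[ℝ] (r → ℝ))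

/-- The branch voltages, in terms of the variables `(y, z)`. -/
noncomputable def branchVoltage (x : Var c l r u j → ℝ) : Branch c l r u j → ℝ
  | .mem => N.memristance (qm x) * im x
  | .cap k => vc x k
  | .ind k => vl x k
  | .res k => N.γ (ir x) k
  | .vsrc k => N.Vs k
  | .isrc k => vj x k

/-- The branch currents, in terms of the variables `(y, z)`. -/
def branchCurrent (x : Var c l r u j → ℝ) : Branch c l r u j → ℝ
  | .mem => im x
  | .cap k => ic x k
  | .ind k => il x k
  | .res k => ir x k
  | .vsrc k => iu x k
  | .isrc k => N.Is k

section Model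

variable [Fintype c] [Fintype l] [Fintype u] [Fintype j]
variable {ι κ : Type*} (B : Matrix ι (Branch c l r u j) ℝ) (Q : Matrix κ (Branch c l r u j) ℝ)

/-- The right-hand side `g(y, z)` of the algebraic equations `0 = g(y, z)`: the Kirchhoff voltage
law, written with the loop matrix `B`, and the Kirchhoff current law, written with the cutset
matrix `Q`. -/
noncomputable def g (x : Var c l r u j → ℝ) : ι ⊕ κ → ℝ :=
  Sum.elim (B.mulVec (N.branchVoltage x)) (Q.mulVec (N.branchCurrent x))

/-- The point `x = (y, z)` is an equilibrium of
`q_m' = i_m`, `C(v_c) v_c' = i_c`, `L(i_l) i_l' = v_l`, `0 = g(y, z)`. -/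
def IsEquilibrium (x : Var c l r u j → ℝ) : Prop :=
  im x = 0 ∧ ic x = 0 ∧ vl x = 0 ∧ N.g B Q x = 0

variable [DecidableEq c] [DecidableEq l]

/-- The right-hand side `h(y, z)` of the differential equations `y' = h(y, z)`:
`q_m' = i_m`, `v_c' = C(v_c)⁻¹ i_c`, `i_l' = L(i_l)⁻¹ v_l`. -/
noncomputable def h (x : Var c l r u j → ℝ) : Dyn c l → ℝ
  | .charge => im x
  | .vcap k => ((N.C (vc x))⁻¹).mulVec (ic x) k
  | .iind k => ((N.L (il x))⁻¹).mulVec (vl x) k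

/-- The map `F = (h, g)` of the semiexplicit system `y' = h(y, z)`, `0 = g(y, z)`. -/
noncomputable def F (x : Var c l r u j → ℝ) : Dyn c l ⊕ (ι ⊕ κ) → ℝ :=
  Sum.elim (N.h x) (N.g B Q x)

variable [DecidableEq r] [DecidableEq u] [DecidableEq j] [Fintype ι] [Fintype κ]

/-- The Jacobian matrix `F'(y, z)` at the point `x = (y, z)`. -/
noncomputable def jacobian (x : Var c l r u j → ℝ) :
    Matrix (Dyn c l ⊕ (ι ⊕ κ)) (Var c l r u j) ℝ :=
  LinearMap.toMatrix'
    (fderiv ℝ (N.F B Q) x : (Var c l r u j → ℝ) →ₗ[ℝ] (Dyn c l ⊕ (ι ⊕ κ) → ℝ))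

open Polynomial in
/-- The matrix pencil `λ E - F'(y, z)` with `E = diag(I, 0)`, as a matrix of polynomials in `λ`. -/
noncomputable def pencil (x : Var c l r u j → ℝ) :
    Matrix (Dyn c l ⊕ (ι ⊕ κ)) (Var c l r u j) ℝ[X] :=
  (X : ℝ[X]) • Matrix.fromBlocks 1 0 0 0 - (N.jacobian B Q x).map Polynomial.C

/-- The determinant of the matrix pencil. The algebraic equations are as many as the branches, and
`σ` lists the former in terms of the latter; the choice of `σ` only affects the sign. -/
noncomputable def pencilDet (σ : ι ⊕ κ ≃ Branch c l r u j) (x : Var c l r u j → ℝ) :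
    Polynomial ℝ :=
  (Matrix.reindex (Equiv.sumCongr (Equiv.refl (Dyn c l)) σ) (Equiv.refl (Var c l r u j))
    (N.pencil B Q x)).det

/-- The algebraic multiplicity of the eigenvalue zero of the linearization at `x`, that is, of zero
as a root of the determinant of the matrix pencil. (If that determinant vanishes identically, the
value is `0`.) -/
noncomputable def zeroMultiplicity (σ : ι ⊕ κ ≃ Branch c l r u j) (x : Var c l r u j → ℝ) : ℕ :=
  (N.pencilDet B Q σ x).rootMultiplicity 0

end Model

/-! ### Configurations and trees -/

/-- voltage sources and capacitors -/
def branchesVC : Set (Branch c l r u j) := {b | (∃ k, b = .vsrc k) ∨ ∃ k, b = .cap k}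
/-- current sources and inductors -/
def branchesIL : Set (Branch c l r u j) := {b | (∃ k, b = .isrc k) ∨ ∃ k, b = .ind k}
/-- voltage sources and inductors -/
def branchesVL : Set (Branch c l r u j) := {b | (∃ k, b = .vsrc k) ∨ ∃ k, b = .ind k}
/-- current sources and capacitors -/
def branchesIC : Set (Branch c l r u j) := {b | (∃ k, b = .isrc k) ∨ ∃ k, b = .cap k}

/-- The circuit has a loop composed only of branches from `S`. -/
def HasLoopIn (S : Set (Branch c l r u j)) : Prop := ∃ K ⊆ S, N.graph.IsLoop K

/-- The circuit has a cutset composed only of branches from `S`. -/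
def HasCutsetIn (S : Set (Branch c l r u j)) : Prop := ∃ K ⊆ S, N.graph.IsCutset K

/-- A proper tree: a spanning tree that includes all voltage sources and capacitors, and neither
current sources nor inductors. -/
def IsProperTree (T : Set (Branch c l r u j)) : Prop :=
  N.graph.IsSpanningTree T ∧ branchesVC ⊆ T ∧ Disjoint branchesIL T

/-- An L-proper tree: a spanning tree that includes all voltage sources and inductors, and neither
current sources nor capacitors. -/
def IsLProperTree (T : Set (Branch c l r u j)) : Prop :=
  N.graph.IsSpanningTree T ∧ branchesVL ⊆ T ∧ Disjoint branchesIC T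

variable [DecidableEq r]

/-- The memristance or resistance of a branch at the point `x`; all the other branches get the
value `1`. -/
noncomputable def branchMR (x : Var c l r u j → ℝ) : Branch c l r u j → ℝ
  | .mem => N.memristance (qm x)
  | .res k => N.resistance (ir x) k k
  | _ => 1

variable [Fintype c] [Fintype l] [Fintype u] [Fintype j]

open Classical in
/-- The MR-product of a tree: the product of the resistances and memristances in the cotree. -/
noncomputable def MRProduct (x : Var c l r u j → ℝ) (T : Finset (Branch c l r u j)) : ℝ :=
  ∏ b ∈ Tᶜ, N.branchMR x b

open Classical in
/-- The sum of the MR-products over the proper trees. -/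
noncomputable def properTreeSum (x : Var c l r u j → ℝ) : ℝ :=
  ∑ T ∈ Finset.univ.filter
    (fun T : Finset (Branch c l r u j) => N.IsProperTree (T : Set (Branch c l r u j))),
    N.MRProduct x T

open Classical in
/-- The sum of the MR-products over the L-proper trees. -/
noncomputable def lProperTreeSum (x : Var c l r u j → ℝ) : ℝ :=
  ∑ T ∈ Finset.univ.filter
    (fun T : Finset (Branch c l r u j) => N.IsLProperTree (T : Set (Branch c l r u j))),
    N.MRProduct x T

end Circuit

end Memristive

/-! At an equilibrium `i_m = 0`, so the product `M(q_m) i_m` contributes no derivative in `q_m`: the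
charge column of `F'` vanishes and that of the pencil is `λ` times the unit vector of the charge
equation. This gives one factor `λ` of the determinant. At `λ = 0` the cofactor is the determinant
of `-F'` with the charge column replaced by this unit vector. A kernel vector of that matrix amounts
to a linear DC solution in which capacitor currents and inductor voltages vanish
(`exists_jacobian_mulVec_eq_single`), hence the second factor `λ` (`X_sq_dvd_det`).

Both the existence of this solution and the regularity of the pencil are read off from one tree
formula, `exists_det_weightedRows_eq_sum`: the determinant of the `a`-weighted loop matrix stacked
on the `b`-weighted cutset matrix is a nonzero constant times the sum, over spanning trees, of the
cotree product of `a` and the tree product of `b`. A zero of `a` forces a branch into the tree, a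
zero of `b` forces it out. Proper trees thus give the determinant of `∂g/∂z`, whose invertibility
makes the pencil regular; L-proper trees give the determinant of the DC problem, which is singular.

All trees enter with the same sign because row spaces of `B` and `Q` are orthogonal: complementary
minors are then proportional, so each term becomes a squared minor of `Q`
(`det_weightedRows_mul_det`), and unimodularity of the incidence matrix makes these squares constant
on trees and zero elsewhere. -/

namespace Memristive.MultiDigraph

/-! ### Loops, cutsets and node potentials. -/

section Coboundary

variable {V E : Type*} (G : MultiDigraph V E)

/-- The differences of a node potential along the edges. -/
def coboundary (p : V → ℝ) : E → ℝ := fun e => p (G.dst e) - p (G.src e)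

variable {G}

theorem IsLoopVector.sum_mul_coboundary [Fintype E] {w : E → ℝ} (h : G.IsLoopVector w)
    (p : V → ℝ) : ∑ e, w e * G.coboundary p e = 0 := by
  obtain ⟨n, v, e, s, ⟨-, he, hs⟩, hw, hw0⟩ := h
  have h1 : ∑ b, w b * G.coboundary p b = ∑ i, w (e i) * G.coboundary p (e i) := by
    refine (Fintype.sum_of_injective e he _ _ ?_ fun _ => rfl).symm
    intro b hb
    rw [hw0 b hb, zero_mul]
  have h2 : ∀ i, w (e i) * G.coboundary p (e i) = p (v (i + 1)) - p (v i) := by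
    intro i
    rw [hw i, coboundary]
    rcases hs i with ⟨h, h', h''⟩ | ⟨h, h', h''⟩ <;> rw [h, h', h''] <;> ring
  rw [h1, Finset.sum_congr rfl fun i _ => h2 i, Finset.sum_sub_distrib, sub_eq_zero]
  exact Equiv.sum_comp (Equiv.addRight (1 : Fin (n + 1))) fun i => p (v i)

theorem IsLoop.exists_isLoopVector {K : Set E} (h : G.IsLoop K) :
    ∃ w : E → ℝ, G.IsLoopVector w ∧ (∀ e, e ∉ K → w e = 0) ∧ ∃ e ∈ K, w e ≠ 0 := by
  obtain ⟨n, v, e, s, ht, rfl⟩ := h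
  have hw : ∀ i, Function.extend e s 0 (e i) = s i := fun i => ht.2.1.extend_apply _ _ _
  have hw0 : ∀ b, b ∉ Set.range e → Function.extend e s 0 b = 0 :=
    fun b hb => Function.extend_apply' _ _ _ hb
  refine ⟨Function.extend e s 0, ⟨n, v, e, s, ht, hw, hw0⟩, hw0, e 0, ⟨0, rfl⟩, ?_⟩
  rw [hw]
  rcases ht.2.2 0 with h | h <;> rw [h.1] <;> norm_num

/-- The potential is `-1` on the component `a` and `0` elsewhere, so an edge from `a` to `b` gets
`+1`; edges outside the cutset stay within one component and get `0`. -/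
theorem IsCutsetVector.exists_eq_coboundary {w : E → ℝ} (h : G.IsCutsetVector w) :
    ∃ p : V → ℝ, w = G.coboundary p := by
  classical
  obtain ⟨K, -, a, b, hab, hK, hK0⟩ := h
  refine ⟨fun v => if (G.subgraph Kᶜ).connectedComponentMk v = a then -1 else 0, ?_⟩
  funext e
  rw [coboundary]
  by_cases he : e ∈ K
  · rcases hK e he with ⟨h, h', h''⟩ | ⟨h, h', h''⟩ <;> simp [h, h', h'', hab.symm]
  · have : (G.subgraph Kᶜ).connectedComponentMk (G.src e)
        = (G.subgraph Kᶜ).connectedComponentMk (G.dst e) := by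
      by_cases hne : G.src e = G.dst e
      · rw [hne]
      · exact SimpleGraph.ConnectedComponent.sound
          (SimpleGraph.Adj.reachable ⟨hne, e, he, .inl ⟨rfl, rfl⟩⟩)
    simp [hK0 e he, this]

theorem coboundary_eq_zero_of_reachable {T : Set E} {p : V → ℝ}
    (hp : ∀ e ∈ T, G.coboundary p e = 0) {a b : V} (h : (G.subgraph T).Reachable a b) :
    p a = p b := by
  obtain ⟨q⟩ := h
  induction q with
  | nil => rfl
  | cons hadj _ ih =>
    rw [← ih]
    obtain ⟨-, e, he, ⟨h1, h2⟩ | ⟨h1, h2⟩⟩ := hadj <;>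
      have := hp e he <;> rw [coboundary, h1, h2] at this <;> linarith

/-- The indicator function of a connected component of the subgraph has zero coboundary on the
subgraph. -/
theorem coboundary_indicator_eq_zero {T : Set E} (a : V)
    [∀ v, Decidable ((G.subgraph T).Reachable a v)] {e : E} (he : e ∈ T) :
    G.coboundary (fun v => if (G.subgraph T).Reachable a v then 1 else 0) e = 0 := by
  have : (G.subgraph T).Reachable (G.src e) (G.dst e) := by
    by_cases hne : G.src e = G.dst e
    · rw [hne]
    · exact SimpleGraph.Adj.reachable ⟨hne, e, he, .inl ⟨rfl, rfl⟩⟩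
  have h2 : (G.subgraph T).Reachable a (G.dst e) ↔ (G.subgraph T).Reachable a (G.src e) :=
    ⟨fun h => h.trans this.symm, fun h => h.trans this⟩
  simp [coboundary, h2]

/-- An edge closes a loop with a path between its end nodes. -/
theorem exists_isLoop_of_reachable {T : Set E} {e : E} (he : e ∈ T)
    (h : (G.subgraph (T \ {e})).Reachable (G.dst e) (G.src e)) : ∃ K ⊆ T, G.IsLoop K := by
  classical
  obtain ⟨p, hp⟩ := h.exists_isPath
  set n := p.length with hn
  have hadj : ∀ i : ℕ, i < n → ∃ f ∈ T \ {e},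
      (G.src f = p.getVert i ∧ G.dst f = p.getVert (i + 1)) ∨
      (G.src f = p.getVert (i + 1) ∧ G.dst f = p.getVert i) :=
    fun i hi => (p.adj_getVert_succ hi).2
  choose f hfT hf using hadj
  have hinj : ∀ i j : ℕ, i ≤ n → j ≤ n → p.getVert i = p.getVert j → i = j :=
    fun i j hi hj hij => hp.getVert_injOn (by simpa using hi) (by simpa using hj) hij
  have hfinj : ∀ i j (hi : i < n) (hj : j < n), f i hi = f j hj → i = j := by
    intro i j hi hj hij
    have h1 := hf i hi
    have h2 := hf j hj
    rw [hij] at h1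
    rcases h1 with ⟨h1, h1'⟩ | ⟨h1, h1'⟩ <;> rcases h2 with ⟨h2, h2'⟩ | ⟨h2, h2'⟩
    · exact hinj _ _ hi.le hj.le (h1.symm.trans h2)
    · have e1 := hinj _ _ hi.le (by omega) (h1.symm.trans h2)
      have e2 := hinj _ _ (by omega) hj.le (h1'.symm.trans h2')
      omega
    · have e1 := hinj _ _ (by omega) hj.le (h1.symm.trans h2)
      have e2 := hinj _ _ hi.le (by omega) (h1'.symm.trans h2')
      omega
    · exact hinj _ _ hi.le hj.le (h1'.symm.trans h2')
  let v : Fin (n + 1) → V := fun i => p.getVert i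
  -- The last index carries `e`, which leads back to the start of the path because addition in `Fin
  -- (n + 1)` wraps around; `n = 0` is the case of a self-loop.
  let g : Fin (n + 1) → E := fun i => if hi : (i : ℕ) < n then f i hi else e
  refine ⟨Set.range g, ?_, n, v, g, fun i => if G.src (g i) = v i ∧ G.dst (g i) = v (i + 1)
    then 1 else -1, ⟨?_, ?_, ?_⟩, rfl⟩
  · rintro _ ⟨i, rfl⟩
    by_cases hi : (i : ℕ) < n
    · simpa [g, hi] using (hfT i hi).1
    · simpa [g, hi] using he
  · intro i j hij
    exact Fin.ext (hinj _ _ (by omega) (by omega) hij)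
  · intro i j hij
    apply Fin.ext
    by_cases hi : (i : ℕ) < n <;> by_cases hj : (j : ℕ) < n <;> simp only [g, hi, hj, dif_pos,
      dif_neg, not_false_eq_true] at hij
    · exact hfinj _ _ hi hj hij
    · exact absurd hij (hfT i hi).2
    · exact absurd hij.symm (hfT j hj).2
    · omega
  · intro i
    have key : (G.src (g i) = v i ∧ G.dst (g i) = v (i + 1)) ∨
        (G.dst (g i) = v i ∧ G.src (g i) = v (i + 1)) := by
      by_cases hi : (i : ℕ) < n
      · have hv : v (i + 1) = p.getVert ((i : ℕ) + 1) := by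
          simp only [v]
          rw [Fin.val_add_one_of_lt (by simpa [Fin.lt_def] using hi)]
        simp only [g, hi, dif_pos, hv]
        exact (hf i hi).imp id And.symm
      · have hi' : i = Fin.last n := Fin.ext (by simp; omega)
        subst hi'
        simp [g, v, hn]
    by_cases hk : G.src (g i) = v i ∧ G.dst (g i) = v (i + 1)
    · exact .inl ⟨if_pos hk, hk⟩
    · exact .inr ⟨if_neg hk, key.resolve_left hk⟩

end Coboundary

/-! ### Unimodularity of the reduced incidence matrix. -/

section Incidence

variable {V E : Type*} (G : MultiDigraph V E) (o : V)

open Classical in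
/-- The incidence matrix without the row of the reference node `o`. -/
noncomputable def reducedIncidence (R : Type*) [Ring R] : Matrix {v // v ≠ o} E R :=
  fun v e => (if G.dst e = v then 1 else 0) - (if G.src e = v then 1 else 0)

theorem map_reducedIncidence :
    (G.reducedIncidence o ℤ).map (Int.castRingHom ℝ) = G.reducedIncidence o ℝ := by
  ext v e
  rw [Matrix.map_apply, reducedIncidence, reducedIncidence]
  split_ifs <;> simp

theorem sum_sub_mul_reducedIncidence [Fintype V] [Fintype {v // v ≠ o}] (p : V → ℝ) (e : E) :
    ∑ v : {v // v ≠ o}, (p v - p o) * G.reducedIncidence o ℝ v e = G.coboundary p e := by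
  classical
  have key : ∀ a : V, ∑ v : {v // v ≠ o}, (p v - p o) * (if a = v then 1 else 0) = p a - p o := by
    intro a
    by_cases ha : a = o
    · subst ha
      rw [sub_self]
      refine Finset.sum_eq_zero fun v _ => ?_
      rw [if_neg v.2.symm, mul_zero]
    · rw [Finset.sum_eq_single ⟨a, ha⟩]
      · simp
      · intro v _ hv
        rw [if_neg, mul_zero]
        rintro rfl
        exact hv rfl
      · simp
  simp only [reducedIncidence, mul_sub, Finset.sum_sub_distrib]
  rw [key, key, coboundary]
  ring

variable {G o}

/-- The signed edges of a path from `b` to `o` sum to a unit vector at `b`, since the row of `o` is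
omitted. The coefficients are integers, which yields an integral inverse below. -/
theorem exists_int_mulVec_reducedIncidence {κ : Type*} [Fintype κ] (t : κ → E)
    {b : V} (h : (G.subgraph (Set.range t)).Reachable b o) :
    ∃ w : κ → ℤ, ∀ v : {v // v ≠ o},
      ∑ k, G.reducedIncidence o ℤ v (t k) * w k = (open Classical in if b = v then 1 else 0) := by
  classical
  obtain ⟨q⟩ := h
  induction q with
  | nil => exact ⟨0, fun v => by simp [v.2.symm]⟩
  | cons hadj _ ih =>
    obtain ⟨w, hw⟩ := ih
    obtain ⟨-, _, ⟨k, rfl⟩, ⟨h1, h2⟩ | ⟨h1, h2⟩⟩ := hadj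
    · refine ⟨w - Pi.single k 1, fun v => ?_⟩
      simp only [Pi.sub_apply, mul_sub, Finset.sum_sub_distrib, hw v]
      simp [Pi.single_apply, reducedIncidence, h1, h2]
    · refine ⟨w + Pi.single k 1, fun v => ?_⟩
      simp only [Pi.add_apply, mul_add, Finset.sum_add_distrib, hw v]
      simp [Pi.single_apply, reducedIncidence, h1, h2]

variable {κ : Type*} [Fintype κ] [DecidableEq κ] {t : κ → E}

/-- The path vectors form an inverse over `ℤ`, so the determinant is a unit of `ℤ`. -/
theorem sq_det_reducedIncidence_of_connected (f : κ ≃ {v // v ≠ o})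
    (h : (G.subgraph (Set.range t)).Connected) :
    ((G.reducedIncidence o ℝ).submatrix f t).det ^ 2 = 1 := by
  classical
  choose w hw using fun j : κ => exists_int_mulVec_reducedIncidence (o := o) t
    (h.preconnected (f j : V) o)
  have h1 : (G.reducedIncidence o ℤ).submatrix f t * Matrix.of (fun k j => w j k) = 1 := by
    ext i j
    rw [Matrix.mul_apply]
    simp only [Matrix.submatrix_apply, Matrix.of_apply]
    rw [hw j (f i)]
    by_cases hij : i = j
    · subst hij
      rw [if_pos rfl, Matrix.one_apply_eq]
    · have : (f j : V) ≠ f i := fun h => hij (f.injective (Subtype.ext h)).symm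
      rw [if_neg this, Matrix.one_apply_ne hij]
  have h2 : IsUnit ((G.reducedIncidence o ℤ).submatrix f t).det :=
    IsUnit.of_mul_eq_one _ (by rw [← Matrix.det_mul, h1, Matrix.det_one])
  have h3 : ((G.reducedIncidence o ℝ).submatrix f t).det
      = ((((G.reducedIncidence o ℤ).submatrix f t).det : ℤ) : ℝ) := by
    rw [← map_reducedIncidence, Matrix.submatrix_map]
    exact ((Int.castRingHom ℝ).map_det _).symm
  rw [h3]
  exact_mod_cast Int.isUnit_sq h2

theorem det_reducedIncidence_eq_zero [Fintype V] (f : κ ≃ {v // v ≠ o}) {p : V → ℝ}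
    (hp : ∀ k, G.coboundary p (t k) = 0) {a : V} (ha : p a ≠ p o) :
    ((G.reducedIncidence o ℝ).submatrix f t).det = 0 := by
  classical
  apply Matrix.exists_vecMul_eq_zero_iff.mp
  refine ⟨fun k => p (f k) - p o, fun h => ?_, ?_⟩
  · have hao : a ≠ o := fun h => ha (h ▸ rfl)
    have := congrFun h (f.symm ⟨a, hao⟩)
    simp only [Equiv.apply_symm_apply, Pi.zero_apply] at this
    exact ha (sub_eq_zero.mp this)
  · funext k
    rw [Matrix.vecMul, dotProduct]
    simp only [Matrix.submatrix_apply]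
    rw [Equiv.sum_comp f fun v => (p v - p o) * G.reducedIncidence o ℝ v (t k),
      sum_sub_mul_reducedIncidence, hp]
    rfl

theorem det_reducedIncidence_of_not_connected [Fintype V] (f : κ ≃ {v // v ≠ o})
    (h : ¬ (G.subgraph (Set.range t)).Connected) :
    ((G.reducedIncidence o ℝ).submatrix f t).det = 0 := by
  classical
  have : ∃ a, ¬ (G.subgraph (Set.range t)).Reachable o a := by
    by_contra! hcon
    exact h ((SimpleGraph.connected_iff_exists_forall_reachable _).mpr ⟨o, hcon⟩)
  obtain ⟨a, ha⟩ := this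
  refine det_reducedIncidence_eq_zero f
    (p := fun v => if (G.subgraph (Set.range t)).Reachable o v then 1 else 0)
    (fun k => coboundary_indicator_eq_zero o (Set.mem_range_self k)) (a := a) ?_
  simp [ha]

/-- A vector orthogonal to all the coboundaries is in the kernel of the incidence matrix. -/
theorem reducedIncidence_mulVec_eq_zero [Fintype V] [Fintype E] {w : E → ℝ}
    (hw : ∀ p, ∑ e, w e * G.coboundary p e = 0) :
    (G.reducedIncidence o ℝ).mulVec w = 0 := by
  classical
  funext v
  rw [Matrix.mulVec, dotProduct, Pi.zero_apply, ← hw (Pi.single (v : V) 1)]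
  refine Finset.sum_congr rfl fun e _ => ?_
  rw [mul_comm]
  simp [reducedIncidence, coboundary, Pi.single_apply]

/-- With `|V| - 1` edges connectedness excludes loops: a loop vector would be a kernel vector of a
matrix of determinant `±1`. -/
theorem isSpanningTree_range_iff [Fintype V] [Fintype E] (f : κ ≃ {v // v ≠ o})
    (ht : Function.Injective t) :
    G.IsSpanningTree (Set.range t) ↔ (G.subgraph (Set.range t)).Connected := by
  classical
  refine ⟨fun h => h.1, fun h => ⟨h, fun K hK hloop => ?_⟩⟩
  obtain ⟨w, hw, hw0, e, he, hwe⟩ := hloop.exists_isLoopVector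
  have h1 := sq_det_reducedIncidence_of_connected f h
  have h2 : ((G.reducedIncidence o ℝ).submatrix f t).det = 0 := by
    apply Matrix.exists_mulVec_eq_zero_iff.mp
    obtain ⟨k, rfl⟩ := hK he
    refine ⟨w ∘ t, fun h => hwe (congrFun h k), ?_⟩
    funext i
    have h3 := congrFun (reducedIncidence_mulVec_eq_zero (o := o) hw.sum_mul_coboundary) (f i)
    refine Eq.trans ?_ h3
    refine Fintype.sum_of_injective t ht _ _ ?_ fun _ => rfl
    intro b hb
    rw [hw0 b fun hbK => hb (hK hbK), mul_zero]
  rw [h2] at h1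
  norm_num at h1

end Incidence

/-! ### The number of edges of a spanning tree. -/

section SpanningTree

variable {V E : Type*} {G : MultiDigraph V E} [Fintype V] [Fintype E]

/-- Acyclicity makes the columns of the incidence matrix on `T` independent, connectedness makes its
rows independent; the two rank bounds meet. -/
theorem IsSpanningTree.card_add_one {T : Finset E} (h : G.IsSpanningTree (T : Set E)) :
    T.card + 1 = Fintype.card V := by
  classical
  obtain ⟨o⟩ := h.1.nonempty
  have hV : Fintype.card {v // v ≠ o} + 1 = Fintype.card V := by
    have := Fintype.card_pos_iff.mpr ⟨o⟩
    rw [Fintype.card_subtype_compl, Fintype.card_subtype_eq]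
    omega
  rw [← hV, ← Fintype.card_coe]
  congr 1
  let D : Matrix {v // v ≠ o} T ℝ := (G.reducedIncidence o ℝ).submatrix id (↑)
  apply le_antisymm
  · have hinj : Function.Injective D.mulVecLin := by
      rw [← LinearMap.ker_eq_bot, LinearMap.ker_eq_bot']
      intro w hw
      funext e
      rw [Matrix.mulVecLin_apply] at hw
      -- Without a loop, deleting `e` separates its ends, so this indicator has coboundary `1` at
      -- `e` and `0` on the rest of `T`; pairing it with `w` isolates `w e`.
      set p : V → ℝ := fun v =>
        if (G.subgraph ((T : Set E) \ {↑e})).Reachable (G.dst e) v then 1 else 0 with hp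
      have h1 : ∑ k : T, G.coboundary p k * w k = 0 := by
        simp only [← sum_sub_mul_reducedIncidence G o p, Finset.sum_mul]
        rw [Finset.sum_comm]
        refine Finset.sum_eq_zero fun v _ => ?_
        have := congrFun hw v
        simp only [mul_assoc]
        rw [← Finset.mul_sum]
        exact mul_eq_zero_of_right _ this
      rw [Finset.sum_eq_single e] at h1
      · have h2 : ¬ (G.subgraph ((T : Set E) \ {↑e})).Reachable (G.dst e) (G.src e) := by
          intro hr
          obtain ⟨K, hK, hl⟩ := exists_isLoop_of_reachable e.2 hr
          exact h.2 K hK hl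
        simpa [coboundary, hp, h2] using h1
      · intro k _ hk
        have hkT : (k : E) ∈ (T : Set E) \ {↑e} := ⟨k.2, fun h => hk (Subtype.ext h)⟩
        rw [hp, coboundary_indicator_eq_zero _ hkT, zero_mul]
      · simp
    simpa using LinearMap.finrank_le_finrank_of_injective hinj
  · have hinj : Function.Injective D.vecMulLinear := by
      rw [← LinearMap.ker_eq_bot, LinearMap.ker_eq_bot']
      intro q hq
      rw [Matrix.vecMulLinear_apply] at hq
      -- Extended by zero at `o`, a left kernel vector is a potential constant along `T`, hence
      -- zero.
      set p : V → ℝ := fun v => if hv : v ≠ o then q ⟨v, hv⟩ else 0 with hp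
      have h1 : ∀ e ∈ (T : Set E), G.coboundary p e = 0 := by
        intro e he
        rw [← sum_sub_mul_reducedIncidence G o p]
        refine Eq.trans ?_ (congrFun hq ⟨e, he⟩)
        rw [Matrix.vecMul, dotProduct]
        refine Finset.sum_congr rfl fun v _ => ?_
        simp [hp, v.2, D]
      funext v
      have := coboundary_eq_zero_of_reachable h1 (h.1.preconnected (v : V) o)
      simpa [hp, v.2] using this
    simpa using LinearMap.finrank_le_finrank_of_injective hinj

end SpanningTree

end Memristive.MultiDigraph

namespace Memristive

/-! ### Determinants of weighted loop and cutset matrices. -/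

section WeightedMatrix

variable {ι κ E : Type*}

/-- The columns of `B` weighted by `a`, above the columns of `Q` weighted by `b`. -/
def weightedRows (B : Matrix ι E ℝ) (Q : Matrix κ E ℝ) (a b : E → ℝ) : Matrix (ι ⊕ κ) E ℝ :=
  Matrix.of (Sum.elim (fun i e => B i e * a e) (fun k e => Q k e * b e))

/-- For a square matrix, permuting rows and columns changes the determinant by a factor which does
not depend on the matrix. -/
theorem det_submatrix_equiv_equiv {m n R : Type*} [Fintype m] [DecidableEq m] [Fintype n]
    [DecidableEq n] [CommRing R] (A : Matrix m m R) (e₁ e₂ : n ≃ m) :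
    (A.submatrix e₁ e₂).det = A.det * ((1 : Matrix m m R).submatrix e₁ e₂).det := by
  conv_lhs => rw [← Matrix.mul_one A, ← Matrix.submatrix_mul_equiv A 1 e₁ e₁ e₂, Matrix.det_mul,
    Matrix.det_submatrix_equiv_self]

theorem det_mul_transpose_ne_zero [Fintype κ] [DecidableEq κ] [Fintype E] {Q : Matrix κ E ℝ}
    (hQ : LinearIndependent ℝ fun k => Q k) :
    (Q * Q.transpose).det ≠ 0 := by
  intro h
  obtain ⟨z, hz0, hz⟩ := Matrix.exists_vecMul_eq_zero_iff.mpr h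
  apply hz0
  have h1 : Matrix.vecMul z Q = 0 := by
    rw [← Matrix.vecMul_vecMul, Matrix.vecMul_transpose] at hz
    rw [← dotProduct_self_eq_zero, Matrix.vecMul_eq_sum, sum_dotProduct]
    refine Finset.sum_eq_zero fun k _ => ?_
    have := congrFun hz k
    rw [smul_dotProduct, ← Matrix.vecMul_eq_sum]
    exact smul_eq_zero_of_right _ this
  rw [Matrix.vecMul_eq_sum] at h1
  exact funext (Fintype.linearIndependent_iff.mp hQ z h1)

variable [Fintype E] [DecidableEq E]
  (B : Matrix ι E ℝ) (Q : Matrix κ E ℝ) (σ : ι ⊕ κ ≃ E)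

/-- Each column is a `B`-part times `a e` plus a `Q`-part times `b e`. Multilinearity expands over
the set `T` of columns that contribute their `Q`-part. -/
theorem det_weightedRows_expand (a b : E → ℝ) :
    ((weightedRows B Q a b).submatrix σ.symm id).det =
      ∑ T : Finset E, ((∏ e ∈ Tᶜ, a e) * ∏ e ∈ T, b e) *
        ((weightedRows B Q (fun e => if e ∈ T then 0 else 1)
          (fun e => if e ∈ T then 1 else 0)).submatrix σ.symm id).det := by
  let x : E → E → ℝ := fun e e' => Sum.elim (fun i => B i e) 0 (σ.symm e')
  let y : E → E → ℝ := fun e e' => Sum.elim 0 (fun k => Q k e) (σ.symm e')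
  have h0 : ((weightedRows B Q a b).submatrix σ.symm id).det
      = Matrix.detRowAlternating.toMultilinearMap
        ((fun e => b e • y e) + fun e => a e • x e) := by
    rw [← Matrix.det_transpose]
    change Matrix.det _ = Matrix.det _
    congr 1
    ext e e'
    simp only [Matrix.transpose_apply, Matrix.submatrix_apply, weightedRows, Matrix.of_apply, x, y,
      Pi.add_apply, Pi.smul_apply, id]
    cases σ.symm e' <;> simp [mul_comm]
  rw [h0, MultilinearMap.map_add_univ]
  refine Finset.sum_congr rfl fun T _ => ?_
  have h1 : T.piecewise (fun e => b e • y e) (fun e => a e • x e)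
      = fun e => (T.piecewise b a e) • (T.piecewise y x e) := by
    funext e
    by_cases he : e ∈ T <;> simp [he]
  rw [h1, MultilinearMap.map_smul_univ, Finset.prod_piecewise, Finset.univ_inter,
    ← Finset.compl_eq_univ_sdiff, smul_eq_mul, mul_comm (∏ e ∈ T, b e)]
  congr 1
  rw [← Matrix.det_transpose]
  change Matrix.det _ = Matrix.det _
  congr 1
  ext e e'
  simp only [Matrix.transpose_apply, Matrix.submatrix_apply, weightedRows, Matrix.of_apply, id]
  by_cases he : e ∈ T
  · rw [Finset.piecewise_eq_of_mem _ _ _ he]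
    simp only [y]
    cases σ.symm e' <;> simp [he]
  · rw [Finset.piecewise_eq_of_notMem _ _ _ he]
    simp only [x]
    cases σ.symm e' <;> simp [he]

variable {B Q} [Fintype ι] [Fintype κ]

/-- The matrix is block diagonal up to order, so both blocks must have independent rows. This bounds
`|T|` and `|Tᶜ|` below, and the bounds add up to `|E|`. -/
theorem card_eq_of_det_weightedRows_ne_zero (T : Finset E)
    (h : ((weightedRows B Q (fun e => if e ∈ T then 0 else 1)
      (fun e => if e ∈ T then 1 else 0)).submatrix σ.symm id).det ≠ 0) :
    T.card = Fintype.card κ := by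
  classical
  set M := weightedRows B Q (fun e => if e ∈ T then 0 else 1) (fun e => if e ∈ T then 1 else 0)
    with hM
  have hker : ∀ z : ι ⊕ κ → ℝ, Matrix.vecMul z M = 0 → z = 0 := by
    intro z hz
    by_contra hz0
    apply h
    apply Matrix.exists_vecMul_eq_zero_iff.mp
    refine ⟨z ∘ σ.symm, fun h0 => hz0 ?_, ?_⟩
    · funext s
      simpa using congrFun h0 (σ s)
    · funext e
      refine Eq.trans ?_ (congrFun hz e)
      exact Equiv.sum_comp σ.symm fun s => z s * M s e
  have h1 : Fintype.card κ ≤ T.card := by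
    have hinj : Function.Injective (Q.submatrix id ((↑) : T → E)).vecMulLinear := by
      rw [← LinearMap.ker_eq_bot, LinearMap.ker_eq_bot']
      intro z hz
      have := hker (Sum.elim 0 z) ?_
      · funext k
        exact congrFun this (.inr k)
      · funext e
        by_cases he : e ∈ T
        · refine Eq.trans ?_ (congrFun hz ⟨e, he⟩)
          simp [Matrix.vecMul, dotProduct, hM, weightedRows, he]
        · simp [Matrix.vecMul, dotProduct, hM, weightedRows, he]
    simpa using LinearMap.finrank_le_finrank_of_injective hinj
  have h2 : Fintype.card ι ≤ Tᶜ.card := by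
    have hinj : Function.Injective (B.submatrix id ((↑) : (Tᶜ : Finset E) → E)).vecMulLinear := by
      rw [← LinearMap.ker_eq_bot, LinearMap.ker_eq_bot']
      intro z hz
      have := hker (Sum.elim z 0) ?_
      · funext k
        exact congrFun this (.inl k)
      · funext e
        by_cases he : e ∈ T
        · simp [Matrix.vecMul, dotProduct, hM, weightedRows, he]
        · refine Eq.trans ?_ (congrFun hz ⟨e, Finset.mem_compl.mpr he⟩)
          simp [Matrix.vecMul, dotProduct, hM, weightedRows, he]
    simpa [Finset.card_compl] using LinearMap.finrank_le_finrank_of_injective hinj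
  have h3 := Fintype.card_congr σ
  rw [Fintype.card_sum] at h3
  have h4 := Finset.card_compl_add_card T
  omega

/-- Complementary minors of matrices with orthogonal row spaces. -/
theorem det_weightedRows_mul_det [DecidableEq κ] (hBQ : B * Q.transpose = 0) {T : Finset E}
    (t : κ ≃ T) :
    ((weightedRows B Q (fun e => if e ∈ T then 0 else 1)
      (fun e => if e ∈ T then 1 else 0)).submatrix σ.symm id).det * (Q * Q.transpose).det =
    ((weightedRows B Q 1 1).submatrix σ.symm id).det *
      (Q.submatrix id fun k => (t k : E)).det ^ 2 := by
  classical
  have hs : Fintype.card ι = Fintype.card (Tᶜ : Finset E) := by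
    have h3 := Fintype.card_congr σ
    have h4 := Finset.card_compl_add_card T
    have h5 := Fintype.card_congr t
    rw [Fintype.card_sum] at h3
    rw [Fintype.card_coe] at h5 ⊢
    omega
  let s : ι ≃ (Tᶜ : Finset E) := Fintype.equivOfCardEq hs
  let τ₀ : ι ⊕ κ → E := Sum.elim (fun i => (s i : E)) (fun k => (t k : E))
  have hτ : Function.Bijective τ₀ := by
    rw [Fintype.bijective_iff_injective_and_card]
    refine ⟨?_, Fintype.card_congr σ⟩
    rw [Sum.elim_injective]
    refine ⟨Subtype.val_injective.comp s.injective, Subtype.val_injective.comp t.injective, ?_⟩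
    intro i k h
    exact Finset.mem_compl.mp (s i).2 (h ▸ (t k).2)
  let τ : ι ⊕ κ ≃ E := Equiv.ofBijective τ₀ hτ
  have hsT : ∀ i, (s i : E) ∉ T := fun i => Finset.mem_compl.mp (s i).2
  have htT : ∀ k, (t k : E) ∈ T := fun k => (t k).2
  have hperm : ∀ M : Matrix (ι ⊕ κ) E ℝ, (M.submatrix σ.symm id).det =
      (M.submatrix id τ).det * ((1 : Matrix (ι ⊕ κ) (ι ⊕ κ) ℝ).submatrix σ.symm τ.symm).det := by
    intro M
    rw [← det_submatrix_equiv_equiv]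
    congr 1
    ext e e'
    simp
  set B₁ : Matrix ι ι ℝ := B.submatrix id fun i => (s i : E)
  set B₂ : Matrix ι κ ℝ := B.submatrix id fun k => (t k : E)
  set Q₁ : Matrix κ ι ℝ := Q.submatrix id fun i => (s i : E)
  set Q₂ : Matrix κ κ ℝ := Q.submatrix id fun k => (t k : E)
  have e1 : (weightedRows B Q (fun e => if e ∈ T then 0 else 1)
      (fun e => if e ∈ T then 1 else 0)).submatrix id τ = Matrix.fromBlocks B₁ 0 0 Q₂ := by
    ext (i | k) (i' | k') <;> simp [weightedRows, τ, τ₀, hsT, B₁, Q₂]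
  have e2 : (weightedRows B Q 1 1).submatrix id τ = Matrix.fromBlocks B₁ B₂ Q₁ Q₂ := by
    ext (i | k) (i' | k') <;> simp [weightedRows, τ, τ₀, B₁, B₂, Q₁, Q₂]
  have split : ∀ f : E → ℝ, ∑ i, f (s i) + ∑ k, f (t k) = ∑ e, f e := by
    intro f
    rw [← Equiv.sum_comp τ f, Fintype.sum_sum_type]
    rfl
  have e3 : B₁ * Q₁.transpose + B₂ * Q₂.transpose = 0 := by
    rw [← hBQ]
    ext i k
    exact split fun e => B i e * Q k e
  have e4 : Q₁ * Q₁.transpose + Q₂ * Q₂.transpose = Q * Q.transpose := by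
    ext i k
    exact split fun e => Q i e * Q k e
  -- The right columns of the factor are `Qᵀ`, so orthogonality kills the upper right block.
  -- Determinants give `det [B; Q] * det Q₂ = det B₁ * det (Q Qᵀ)`, and a further factor `det Q₂`
  -- produces the square.
  have e5 : Matrix.fromBlocks B₁ B₂ Q₁ Q₂ * Matrix.fromBlocks 1 Q₁.transpose 0 Q₂.transpose =
      Matrix.fromBlocks B₁ 0 Q₁ (Q * Q.transpose) := by
    rw [Matrix.fromBlocks_multiply]
    simp [e3, e4]
  have e6 := congrArg Matrix.det e5
  rw [Matrix.det_mul, Matrix.det_fromBlocks_zero₂₁, Matrix.det_fromBlocks_zero₁₂, Matrix.det_one,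
    Matrix.det_transpose, one_mul] at e6
  rw [hperm, hperm, e1, e2, Matrix.det_fromBlocks_zero₂₁]
  linear_combination -(((1 : Matrix (ι ⊕ κ) (ι ⊕ κ) ℝ).submatrix σ.symm τ.symm).det * Q₂.det) * e6

/-- By orthogonality the Gram matrix of the stacked rows is block diagonal, with invertible Gram
matrices of `B` and `Q` as blocks. -/
theorem det_weightedRows_one_ne_zero (hBQ : B * Q.transpose = 0)
    (hB : LinearIndependent ℝ fun i => B i) (hQ : LinearIndependent ℝ fun k => Q k) :
    ((weightedRows B Q 1 1).submatrix σ.symm id).det ≠ 0 := by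
  classical
  set M := weightedRows B Q 1 1 with hM
  have h1 : M * M.transpose = Matrix.fromBlocks (B * B.transpose) 0 0 (Q * Q.transpose) := by
    have h2 : Q * B.transpose = 0 := by
      rw [← Matrix.transpose_eq_zero, Matrix.transpose_mul, Matrix.transpose_transpose, hBQ]
    ext (i | k) (i' | k')
    · simp [Matrix.mul_apply, hM, weightedRows]
    · simpa [Matrix.mul_apply, hM, weightedRows] using congrFun (congrFun hBQ i) k'
    · simpa [Matrix.mul_apply, hM, weightedRows] using congrFun (congrFun h2 k) i'
    · simp [Matrix.mul_apply, hM, weightedRows]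
  have h2 : (M.submatrix σ.symm id).det ^ 2 = (B * B.transpose).det * (Q * Q.transpose).det := by
    rw [← Matrix.det_fromBlocks_zero₂₁, ← h1, ← Matrix.det_submatrix_equiv_self σ.symm, sq]
    nth_rw 2 [← Matrix.det_transpose]
    rw [← Matrix.det_mul]
    rfl
  intro h0
  rw [h0, zero_pow two_ne_zero] at h2
  exact mul_ne_zero (det_mul_transpose_ne_zero hB) (det_mul_transpose_ne_zero hQ) h2.symm

end WeightedMatrix

/-! ### The weighted matrix-tree theorem. -/

namespace MultiDigraph

theorem IsReducedCutsetMatrix.card_add_one {V E κ : Type*} [Fintype V] [Fintype κ]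
    {G : MultiDigraph V E} {Q : Matrix κ E ℝ} (hQ : G.IsReducedCutsetMatrix Q) (hG : G.IsConnected) : Fintype.card κ + 1 = Fintype.card V := by
  rw [← hQ.2.2]
  congr 1
  have := hG.preconnected.subsingleton_connectedComponent
  have := hG.nonempty
  exact (Nat.card_eq_one_iff_unique.mpr ⟨inferInstance, inferInstance⟩).symm

variable {V E ι κ : Type*} [Fintype V] [Fintype E] [Fintype ι] [Fintype κ]
  {G : MultiDigraph V E} {B : Matrix ι E ℝ} {Q : Matrix κ E ℝ}

theorem loopMatrix_mul_cutsetMatrix_transpose (hB : G.IsReducedLoopMatrix B)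
    (hQ : G.IsReducedCutsetMatrix Q) : B * Q.transpose = 0 := by
  ext i k
  obtain ⟨p, hp⟩ := (hQ.1 k).exists_eq_coboundary
  rw [Matrix.mul_apply]
  simp only [Matrix.transpose_apply, hp]
  exact (hB.1 i).sum_mul_coboundary p

open Classical in
/-- The squared maximal minors of a reduced cutset matrix are supported on the spanning trees, where
they are constant. -/
theorem IsReducedCutsetMatrix.exists_sq_det (hQ : G.IsReducedCutsetMatrix Q)
    (hG : G.IsConnected) :
    ∃ K : ℝ, K ≠ 0 ∧ ∀ t : κ → E, Function.Injective t →
      (Q.submatrix id t).det ^ 2 = if G.IsSpanningTree (Set.range t) then K else 0 := by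
  obtain ⟨o⟩ := hG.nonempty
  have hV : Fintype.card κ = Fintype.card {v // v ≠ o} := by
    have h1 := hQ.card_add_one hG
    rw [Fintype.card_subtype_compl, Fintype.card_subtype_eq]
    omega
  let f : κ ≃ {v // v ≠ o} := Fintype.equivOfCardEq hV
  choose p hp using fun k => (hQ.1 k).exists_eq_coboundary
  -- `P` is the change of basis from incidence rows to cutset rows: the potentials of the cutsets,
  -- normalized at `o`.
  let P : Matrix κ κ ℝ := Matrix.of fun k k' => p k (f k') - p k o
  have h0 : Q = P * (G.reducedIncidence o ℝ).submatrix f id := by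
    ext k e
    rw [Matrix.mul_apply, hp k, ← sum_sub_mul_reducedIncidence G o, ← Equiv.sum_comp f]
    rfl
  have hP : P.det ≠ 0 := by
    intro h
    apply det_mul_transpose_ne_zero hQ.2.1
    rw [h0, Matrix.mul_assoc, Matrix.det_mul, h, zero_mul]
  refine ⟨P.det ^ 2, pow_ne_zero 2 hP, fun t ht => ?_⟩
  have h1 : Q.submatrix id t = P * (G.reducedIncidence o ℝ).submatrix f t := by
    conv_lhs => rw [h0]
    rfl
  rw [h1, Matrix.det_mul, mul_pow, isSpanningTree_range_iff f ht]
  split_ifs with h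
  · rw [sq_det_reducedIncidence_of_connected f h, mul_one]
  · rw [det_reducedIncidence_of_not_connected f h]
    ring

open Classical in
/-- A weighted matrix-tree theorem for the loop and cutset matrices. -/
theorem exists_det_weightedRows_eq_sum [DecidableEq E] (hG : G.IsConnected)
    (hB : G.IsReducedLoopMatrix B) (hQ : G.IsReducedCutsetMatrix Q) (σ : ι ⊕ κ ≃ E) :
    ∃ K : ℝ, K ≠ 0 ∧ ∀ a b : E → ℝ, ((weightedRows B Q a b).submatrix σ.symm id).det =
      K * ∑ T ∈ Finset.univ.filter (fun T : Finset E => G.IsSpanningTree (T : Set E)),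
        (∏ e ∈ Tᶜ, a e) * ∏ e ∈ T, b e := by
  obtain ⟨K, hK0, hK⟩ := hQ.exists_sq_det hG
  have hBQ := loopMatrix_mul_cutsetMatrix_transpose hB hQ
  have hQQ := det_mul_transpose_ne_zero hQ.2.1
  refine ⟨((weightedRows B Q 1 1).submatrix σ.symm id).det * K / (Q * Q.transpose).det,
    div_ne_zero (mul_ne_zero (det_weightedRows_one_ne_zero σ hBQ hB.2.1 hQ.2.1) hK0) hQQ,
    fun a b => ?_⟩
  rw [det_weightedRows_expand, Finset.mul_sum, Finset.sum_filter]
  refine Finset.sum_congr rfl fun T _ => ?_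
  by_cases hT : T.card = Fintype.card κ
  · let t : κ ≃ T := Fintype.equivOfCardEq (by rw [Fintype.card_coe, hT])
    have h1 := det_weightedRows_mul_det σ hBQ t
    have hr : Set.range (fun k => (t k : E)) = (T : Set E) := by
      rw [← Function.comp_def, Set.range_comp, t.range_eq_univ, Set.image_univ]
      exact Subtype.range_coe
    rw [hK (fun k => (t k : E)) (Subtype.val_injective.comp t.injective), hr] at h1
    rw [eq_div_of_mul_eq hQQ h1]
    split_ifs <;> ring
  · rw [if_neg fun h => hT ?_]
    · rw [mul_eq_zero]
      right
      by_contra h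
      exact hT (card_eq_of_det_weightedRows_ne_zero σ T h)
    · have := h.card_add_one
      have := hQ.card_add_one hG
      omega

end MultiDigraph

end Memristive

/-! ### Matrix pencils and derivatives at zeros of a factor. -/

namespace Memristive

open Polynomial in
/-- A block pencil with invertible algebraic part is regular. -/
theorem det_pencil_ne_zero {m n : Type*} [Fintype m] [DecidableEq m] [Fintype n] [DecidableEq n]
    (J₁₁ : Matrix m m ℝ) (J₁₂ : Matrix m n ℝ) (J₂₁ : Matrix n m ℝ) {J₂₂ : Matrix n n ℝ}
    (h : J₂₂.det ≠ 0) :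
    ((X : ℝ[X]) • Matrix.fromBlocks 1 0 0 0 -
      (Matrix.fromBlocks J₁₁ J₁₂ J₂₁ J₂₂).map Polynomial.C).det ≠ 0 := by
  have hu : IsUnit J₂₂.det := isUnit_iff_ne_zero.mpr h
  -- Eliminating the algebraic variables by a unimodular column operation leaves the characteristic
  -- matrix of the Schur complement, whose determinant is monic.
  have e : ((X : ℝ[X]) • Matrix.fromBlocks 1 0 0 0 -
      (Matrix.fromBlocks J₁₁ J₁₂ J₂₁ J₂₂).map Polynomial.C) *
      Matrix.fromBlocks 1 0 (-(J₂₂⁻¹ * J₂₁).map Polynomial.C) 1 =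
      Matrix.fromBlocks (Matrix.charmatrix (J₁₁ - J₁₂ * (J₂₂⁻¹ * J₂₁))) (-J₁₂.map Polynomial.C) 0
        (-J₂₂.map Polynomial.C) := by
    have h1 : (J₂₂.map Polynomial.C) * ((J₂₂⁻¹ * J₂₁).map Polynomial.C) = J₂₁.map Polynomial.C := by
      rw [← Matrix.map_mul, Matrix.mul_nonsing_inv_cancel_left _ _ hu]
    have h2 : (J₁₂.map Polynomial.C) * ((J₂₂⁻¹ * J₂₁).map Polynomial.C) =
        (J₁₂ * (J₂₂⁻¹ * J₂₁)).map Polynomial.C := Matrix.map_mul.symm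
    have h3 : Matrix.charmatrix (J₁₁ - J₁₂ * (J₂₂⁻¹ * J₂₁)) = (X : ℝ[X]) • 1 - J₁₁.map Polynomial.C
        + (J₁₂ * (J₂₂⁻¹ * J₂₁)).map Polynomial.C := by
      rw [Matrix.charmatrix, RingHom.mapMatrix_apply, Matrix.map_sub _ (by simp),
        Matrix.scalar_apply, ← Matrix.smul_one_eq_diagonal]
      abel
    rw [Matrix.fromBlocks_map, Matrix.fromBlocks_smul, sub_eq_add_neg, Matrix.fromBlocks_neg,
      Matrix.fromBlocks_add,
      Matrix.fromBlocks_multiply, h3]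
    simp only [Matrix.mul_one, Matrix.mul_zero, Matrix.mul_neg, Matrix.neg_mul, neg_neg, h1, h2,
      smul_zero, zero_add, sub_eq_add_neg, neg_add_cancel]
  have e2 := congrArg Matrix.det e
  rw [Matrix.det_mul, Matrix.det_fromBlocks_zero₁₂, Matrix.det_fromBlocks_zero₂₁] at e2
  intro h0
  rw [h0, zero_mul, eq_comm, mul_eq_zero] at e2
  rcases e2 with e2 | e2
  · exact (Matrix.charpoly_monic _).ne_zero e2
  · rw [Matrix.det_neg, mul_eq_zero, ← RingHom.mapMatrix_apply, ← RingHom.map_det] at e2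
    rcases e2 with e2 | e2
    · exact pow_ne_zero _ (neg_ne_zero.mpr one_ne_zero) e2
    · exact h (Polynomial.C_eq_zero.mp e2)

open Polynomial in
/-- If the column `d` is `X` times the unit vector `d` and the matrix sends a nonzero vector `v` to
`-v d` times this unit vector at zero, then zero is a double root of the determinant. -/
theorem X_sq_dvd_det {n : Type*} [Fintype n] [DecidableEq n] (A : Matrix n n ℝ[X]) (d : n)
    (hd : ∀ s, A s d = X * (Pi.single d 1 : n → ℝ[X]) s) {v : n → ℝ} (hv : v ≠ 0)
    (hAv : (A.map (Polynomial.eval 0)).mulVec v = -(v d • Pi.single d 1)) :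
    (X : ℝ[X]) ^ 2 ∣ A.det := by
  have h1 : A.det = X * (A.updateCol d (Pi.single d 1)).det := by
    rw [← Matrix.det_updateCol_smul]
    congr 1
    ext1 s e
    by_cases he : e = d
    · subst he
      simp [hd]
    · simp [he]
  rw [h1, sq]
  refine mul_dvd_mul_left X ?_
  rw [Polynomial.X_dvd_iff, Polynomial.coeff_zero_eq_eval_zero, ← Polynomial.coe_evalRingHom,
    RingHom.map_det]
  apply Matrix.exists_mulVec_eq_zero_iff.mp
  refine ⟨v, hv, ?_⟩
  have h2 : (Polynomial.evalRingHom 0).mapMatrix (A.updateCol d (Pi.single d 1)) =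
      A.map (Polynomial.eval 0) + Matrix.vecMulVec (Pi.single d 1) (Pi.single d 1) := by
    ext s e
    by_cases he : e = d
    · subst he
      by_cases hs : s = e
      · subst hs
        simp [Matrix.vecMulVec_apply, hd]
      · simp [Matrix.vecMulVec_apply, hd, hs]
    · simp [Matrix.vecMulVec_apply, he]
  rw [h2, Matrix.add_mulVec, hAv, Matrix.vecMulVec_mulVec]
  simp

/-- A product has a derivative at a zero of the second factor even if the first factor is merely
continuous. -/
theorem hasFDerivAt_mul_of_eq_zero {W : Type*} [NormedAddCommGroup W] [NormedSpace ℝ W]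
    {f g : W → ℝ} {g' : W →L[ℝ] ℝ} {x : W} (hf : ContinuousAt f x) (hg : HasFDerivAt g g' x)
    (hgx : g x = 0) : HasFDerivAt (fun y => f y * g y) (f x • g') x := by
  rw [hasFDerivAt_iff_isLittleO] at hg ⊢
  -- As `g x = 0`, the remainder splits into `f y` times the remainder of `g` and `(f y - f x) * g'
  -- (y - x)`; continuity of `f` suffices for both.
  have h1 : (fun y => f y * (g y - g x - g' (y - x))) =o[nhds x] fun y => y - x := by
    simpa using (hf.norm.isBoundedUnder_le.isBigO_one ℝ).mul_isLittleO
      (hg.norm_right)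
  have h2 : (fun y => (f y - f x) * g' (y - x)) =o[nhds x] fun y => y - x := by
    have h3 : (fun y => f y - f x) =o[nhds x] fun _ => (1 : ℝ) := by
      rw [Asymptotics.isLittleO_one_iff]
      have := Filter.Tendsto.sub_const hf (f x)
      rwa [sub_self] at this
    have h4 : (fun y => g' (y - x)) =O[nhds x] fun y => y - x :=
      g'.isBigO_comp _ _
    simpa using h3.mul_isBigO h4.norm_right
  refine (h1.add h2).congr_left fun y => ?_
  simp [hgx]
  ring

theorem continuousAt_matrix_inv {W n : Type*} [TopologicalSpace W] [Fintype n] [DecidableEq n]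
    {A : W → Matrix n n ℝ} {x : W} (hA : ContinuousAt A x) (h : (A x).det ≠ 0) :
    ContinuousAt (fun y => (A y)⁻¹) x := by
  simp only [Matrix.inv_def, Ring.inverse_eq_inv']
  have h1 : ContinuousAt (fun y => (A y).det) x := (continuous_id.matrix_det).continuousAt.comp hA
  have h2 : ContinuousAt (fun y => (A y).adjugate) x :=
    (continuous_id.matrix_adjugate).continuousAt.comp hA
  exact (h1.inv₀ h).smul h2

/-! ### Linearization of the circuit equations at the equilibrium. -/

namespace Circuit

variable {V c l r u j : Type*} [Fintype r] (N : Circuit V c l r u j)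

/-- The linearization of the branch voltages at an equilibrium with diagonal resistance matrix. -/
noncomputable def linearVoltage [DecidableEq r] (x δ : Var c l r u j → ℝ) : Branch c l r u j → ℝ
  | .mem => N.branchMR x .mem * im δ
  | .cap k => vc δ k
  | .ind k => vl δ k
  | .res k => N.branchMR x (.res k) * ir δ k
  | .vsrc _ => 0
  | .isrc k => vj δ k

/-- The linearization of the branch currents. -/
def linearCurrent (δ : Var c l r u j → ℝ) : Branch c l r u j → ℝ
  | .mem => im δ
  | .cap k => ic δ k
  | .ind k => il δ k
  | .res k => ir δ k
  | .vsrc k => iu δ k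
  | .isrc _ => 0

/-- The linearization of the right-hand side of the differential equations at an equilibrium. -/
noncomputable def linearDyn [Fintype c] [Fintype l] [DecidableEq c] [DecidableEq l]
    (x δ : Var c l r u j → ℝ) : Dyn c l → ℝ
  | .charge => im δ
  | .vcap k => ((N.C (vc x))⁻¹).mulVec (ic δ) k
  | .iind k => ((N.L (il x))⁻¹).mulVec (vl δ) k

variable {N}

/-- Since `i_m = 0`, the memristor contributes only `M(q_m)` times the current increment;
diagonality of the resistance matrix does the same for each resistor. -/
theorem exists_hasFDerivAt_branchVoltage [Fintype c] [Fintype l] [Fintype u] [Fintype j]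
    [DecidableEq r] {x : Var c l r u j → ℝ}
    (hm : im x = 0) (hR : (N.resistance (ir x)).IsDiag) (b : Branch c l r u j) :
    ∃ f' : (Var c l r u j → ℝ) →L[ℝ] ℝ, HasFDerivAt (fun y => N.branchVoltage y b) f' x ∧
      ∀ δ, f' δ = N.linearVoltage x δ b := by
  have hproj : ∀ s : Var c l r u j, HasFDerivAt (fun y : Var c l r u j → ℝ => y s)
      (ContinuousLinearMap.proj (R := ℝ) s) x := fun s => hasFDerivAt_apply s x
  cases b with
  | mem =>
    have hc : ContinuousAt (fun y : Var c l r u j → ℝ => N.memristance (qm y)) x :=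
      ((N.contDiff_φ.continuous_deriv (by norm_num)).comp
        (continuous_apply (Sum.inl Dyn.charge))).continuousAt
    exact ⟨_, hasFDerivAt_mul_of_eq_zero hc (hproj (.inr .mem)) hm, fun δ => rfl⟩
  | cap k => exact ⟨_, hproj (.inl (.vcap k)), fun δ => rfl⟩
  | ind k => exact ⟨_, hproj (.inr (.ind k)), fun δ => rfl⟩
  | res k =>
    let I : (Var c l r u j → ℝ) →L[ℝ] (r → ℝ) :=
      ContinuousLinearMap.pi fun k => ContinuousLinearMap.proj (R := ℝ) (.inr (.res k))
    have h1 : HasFDerivAt N.γ (fderiv ℝ N.γ (I x)) (I x) :=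
      (N.contDiff_γ.differentiable one_ne_zero _).hasFDerivAt
    refine ⟨_, hasFDerivAt_pi'.mp (h1.comp x I.hasFDerivAt) k, fun δ => ?_⟩
    change fderiv ℝ N.γ (ir x) (ir δ) k = N.resistance (ir x) k k * ir δ k
    have h2 : fderiv ℝ N.γ (ir x) (ir δ) = (N.resistance (ir x)).mulVec (ir δ) := by
      rw [resistance, ← Matrix.toLin'_apply, Matrix.toLin'_toMatrix']
      rfl
    rw [h2, Matrix.mulVec, dotProduct, Finset.sum_eq_single k]
    · intro k' _ hk'
      rw [hR hk'.symm, zero_mul]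
    · simp
  | vsrc k => exact ⟨0, hasFDerivAt_const _ _, fun δ => rfl⟩
  | isrc k => exact ⟨_, hproj (.inr (.isrc k)), fun δ => rfl⟩

theorem exists_hasFDerivAt_branchCurrent (x : Var c l r u j → ℝ) (b : Branch c l r u j) :
    ∃ f' : (Var c l r u j → ℝ) →L[ℝ] ℝ, HasFDerivAt (fun y => N.branchCurrent y b) f' x ∧
      ∀ δ, f' δ = linearCurrent δ b := by
  have hproj : ∀ s : Var c l r u j, HasFDerivAt (fun y : Var c l r u j → ℝ => y s)
      (ContinuousLinearMap.proj (R := ℝ) s) x := fun s => hasFDerivAt_apply s x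
  cases b with
  | mem => exact ⟨_, hproj (.inr .mem), fun δ => rfl⟩
  | cap k => exact ⟨_, hproj (.inr (.cap k)), fun δ => rfl⟩
  | ind k => exact ⟨_, hproj (.inl (.iind k)), fun δ => rfl⟩
  | res k => exact ⟨_, hproj (.inr (.res k)), fun δ => rfl⟩
  | vsrc k => exact ⟨_, hproj (.inr (.vsrc k)), fun δ => rfl⟩
  | isrc k => exact ⟨0, hasFDerivAt_const _ _, fun δ => rfl⟩

/-- The factors `i_c` and `v_l` vanish at the equilibrium, so continuity of the inverse matrices is
enough. -/
theorem exists_hasFDerivAt_h [Fintype c] [Fintype l] [Fintype u] [Fintype j]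
    [DecidableEq c] [DecidableEq l]
    {x : Var c l r u j → ℝ} (hic : ic x = 0) (hvl : vl x = 0) (hC : (N.C (vc x)).det ≠ 0) (hL : (N.L (il x)).det ≠ 0) (s : Dyn c l) :
    ∃ f' : (Var c l r u j → ℝ) →L[ℝ] ℝ, HasFDerivAt (fun y => N.h y s) f' x ∧
      ∀ δ, f' δ = N.linearDyn x δ s := by
  have hproj : ∀ s : Var c l r u j, HasFDerivAt (fun y : Var c l r u j → ℝ => y s)
      (ContinuousLinearMap.proj (R := ℝ) s) x := fun s => hasFDerivAt_apply s x
  cases s with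
  | charge => exact ⟨_, hproj (.inr .mem), fun δ => rfl⟩
  | vcap k =>
    have h1 : ContinuousAt (fun y : Var c l r u j → ℝ => (N.C (vc y))⁻¹) x :=
      continuousAt_matrix_inv (N.continuous_C.comp
        (continuous_pi fun k => continuous_apply _)).continuousAt hC
    refine ⟨_, HasFDerivAt.fun_sum fun k' _ => hasFDerivAt_mul_of_eq_zero
      (f := fun y => (N.C (vc y))⁻¹ k k')
      (continuousAt_pi.mp (continuousAt_pi.mp h1 k) k') (hproj (.inr (.cap k')))
      (congrFun hic k'), fun δ => ?_⟩
    simp [linearDyn, Matrix.mulVec, dotProduct, ic]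
  | iind k =>
    have h1 : ContinuousAt (fun y : Var c l r u j → ℝ => (N.L (il y))⁻¹) x :=
      continuousAt_matrix_inv (N.continuous_L.comp
        (continuous_pi fun k => continuous_apply _)).continuousAt hL
    refine ⟨_, HasFDerivAt.fun_sum fun k' _ => hasFDerivAt_mul_of_eq_zero
      (f := fun y => (N.L (il y))⁻¹ k k')
      (continuousAt_pi.mp (continuousAt_pi.mp h1 k) k') (hproj (.inr (.ind k')))
      (congrFun hvl k'), fun δ => ?_⟩
    simp [linearDyn, Matrix.mulVec, dotProduct, vl]

variable [Fintype c] [Fintype l] [Fintype u] [Fintype j] [DecidableEq c] [DecidableEq l]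
  [DecidableEq r] [DecidableEq u] [DecidableEq j] {ι κ : Type*}
  {B : Matrix ι (Branch c l r u j) ℝ} {Q : Matrix κ (Branch c l r u j) ℝ}

theorem jacobian_mulVec {x : Var c l r u j → ℝ} (hx : N.IsEquilibrium B Q x)
    (hC : (N.C (vc x)).det ≠ 0) (hL : (N.L (il x)).det ≠ 0)
    (hR : (N.resistance (ir x)).IsDiag) (δ : Var c l r u j → ℝ) :
    (N.jacobian B Q x).mulVec δ = Sum.elim (N.linearDyn x δ)
      (Sum.elim (B.mulVec (N.linearVoltage x δ)) (Q.mulVec (linearCurrent δ))) := by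
  choose v' hv' hv using exists_hasFDerivAt_branchVoltage hx.1 hR
  choose i' hi' hi using exists_hasFDerivAt_branchCurrent (N := N) x
  choose h' hh' hh using exists_hasFDerivAt_h hx.2.1 hx.2.2.1 hC hL
  let F' : Dyn c l ⊕ (ι ⊕ κ) → (Var c l r u j → ℝ) →L[ℝ] ℝ :=
    Sum.elim h' (Sum.elim (fun i => ∑ b, B i b • v' b) (fun k => ∑ b, Q k b • i' b))
  have hF : HasFDerivAt (N.F B Q) (ContinuousLinearMap.pi F') x := by
    rw [hasFDerivAt_pi]
    rintro (s | i | k)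
    · exact hh' s
    · exact HasFDerivAt.fun_sum fun b _ => (hv' b).const_mul (B i b)
    · exact HasFDerivAt.fun_sum fun b _ => (hi' b).const_mul (Q k b)
  rw [jacobian, ← Matrix.toLin'_apply, Matrix.toLin'_toMatrix', hF.fderiv]
  funext s
  rcases s with s | i | k
  · exact hh s δ
  · simp [F', hv, Matrix.mulVec, dotProduct]
  · simp [F', hi, Matrix.mulVec, dotProduct]

end Circuit

/-! ### From tree sums to the pencil determinant. -/

open Classical in
/-- Weights which vanish outside `I ⊆ T` and `O ∩ T = ∅` restrict a sum over sets `T`. -/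
theorem sum_prod_ite {E : Type*} [Fintype E] [DecidableEq E] (p : Set E → Prop)
    (I O : Set E) (w : E → ℝ) :
    ∑ T ∈ Finset.univ.filter (fun T : Finset E => p T),
      (∏ e ∈ Tᶜ, if e ∈ I then 0 else w e) * ∏ e ∈ T, (if e ∈ O then 0 else 1 : ℝ) =
    ∑ T ∈ Finset.univ.filter (fun T : Finset E => p T ∧ I ⊆ T ∧ Disjoint O T), ∏ e ∈ Tᶜ, w e := by
  rw [Finset.sum_filter, Finset.sum_filter]
  refine Finset.sum_congr rfl fun T _ => ?_
  by_cases hp : p T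
  swap
  · simp [hp]
  by_cases hI : I ⊆ T
  swap
  · obtain ⟨e, heI, heT⟩ := Set.not_subset.mp hI
    rw [if_pos hp, if_neg fun h => hI h.2.1,
      Finset.prod_eq_zero (s := Tᶜ) (i := e), zero_mul]
    · exact Finset.mem_compl.mpr heT
    · exact if_pos heI
  by_cases hO : Disjoint O T
  · rw [if_pos hp, if_pos ⟨hp, hI, hO⟩, Finset.prod_eq_one (s := T), mul_one]
    · refine Finset.prod_congr rfl fun e he => ?_
      rw [if_neg fun h => Finset.mem_compl.mp he (hI h)]
    · intro e he
      rw [if_neg fun h => Set.disjoint_left.mp hO h he]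
  · obtain ⟨e, heO, heT⟩ := Set.not_disjoint_iff.mp hO
    rw [if_pos hp, if_neg fun h => hO h.2.2, Finset.prod_eq_zero (s := T) (i := e), mul_zero]
    · exact heT
    · exact if_pos heO

end Memristive

namespace Memristive

theorem mulVec_eq_zero_of_submatrix {m n p R : Type*} [NonUnitalNonAssocSemiring R] [Fintype p]
    {M : Matrix m p R} (σ : m ≃ n) {t : p → R} (h : (M.submatrix σ.symm id).mulVec t = 0) :
    M.mulVec t = 0 := by
  funext s
  have := congrFun h (σ s)
  simpa [Matrix.mulVec] using this

namespace Circuit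

variable {V c l r u j ι κ : Type*} [Fintype c] [Fintype l] [Fintype r] [Fintype u]
  [Fintype j] [DecidableEq c] [DecidableEq l] [DecidableEq r] [DecidableEq u] [DecidableEq j]
  {N : Circuit V c l r u j}
  {B : Matrix ι (Branch c l r u j) ℝ} {Q : Matrix κ (Branch c l r u j) ℝ}

open Classical in
theorem exists_det_weightedRows_eq_properTreeSum [Fintype V] [Fintype ι] [Fintype κ]
    (hconn : N.graph.IsConnected)
    (hB : N.graph.IsReducedLoopMatrix B) (hQ : N.graph.IsReducedCutsetMatrix Q)
    (σ : ι ⊕ κ ≃ Branch c l r u j) (x : Var c l r u j → ℝ) :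
    ∃ K : ℝ, K ≠ 0 ∧
      ((weightedRows B Q (fun b => if b ∈ branchesVC then 0 else N.branchMR x b)
        (fun b => if b ∈ branchesIL then 0 else 1)).submatrix σ.symm id).det
        = K * N.properTreeSum x ∧
      ((weightedRows B Q (fun b => if b ∈ branchesVL then 0 else N.branchMR x b)
        (fun b => if b ∈ branchesIC then 0 else 1)).submatrix σ.symm id).det
        = K * N.lProperTreeSum x := by
  obtain ⟨K, hK0, hK⟩ := MultiDigraph.exists_det_weightedRows_eq_sum hconn hB hQ σ
  refine ⟨K, hK0, ?_, ?_⟩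
  · rw [hK, sum_prod_ite, properTreeSum]
    congr 1
    exact Finset.sum_congr (by ext; simp [IsProperTree]) fun T _ => by
      rw [MRProduct]; congr!
  · rw [hK, sum_prod_ite, lProperTreeSum]
    congr 1
    exact Finset.sum_congr (by ext; simp [IsLProperTree]) fun T _ => by
      rw [MRProduct]; congr!

open Classical in
/-- With `y = 0`, the linearized algebraic equations are weighted by the proper trees. -/
theorem toBlocks₂₂_jacobian {x : Var c l r u j → ℝ} (hx : N.IsEquilibrium B Q x)
    (hC : (N.C (vc x)).det ≠ 0) (hL : (N.L (il x)).det ≠ 0)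
    (hR : (N.resistance (ir x)).IsDiag) :
    (N.jacobian B Q x).toBlocks₂₂ =
      weightedRows B Q (fun b => if b ∈ branchesVC then 0 else N.branchMR x b)
        (fun b => if b ∈ branchesIL then 0 else 1) := by
  ext s b
  have h := congrFun (jacobian_mulVec hx hC hL hR (Pi.single (.inr b) 1)) (.inr s)
  rw [Matrix.mulVec_single_one] at h
  refine Eq.trans h ?_
  rcases s with i | k
  · have e : N.linearVoltage x (Pi.single (.inr b) 1) =
        Pi.single b (if b ∈ branchesVC then 0 else N.branchMR x b) := by
      funext b'
      cases b <;> cases b' <;>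
        simp [linearVoltage, branchesVC, im, vc, vl, ir, vj, Pi.single_apply, branchMR]
      exact ite_congr rfl (fun h => by rw [h]) fun _ => rfl
    by_cases hb : b ∈ branchesVC <;> simp [e, weightedRows, hb, mul_comm]
  · have e : linearCurrent (Pi.single (.inr b) 1 : Var c l r u j → ℝ) =
        Pi.single b (if b ∈ branchesIL then 0 else 1) := by
      funext b'
      cases b <;> cases b' <;>
        simp [linearCurrent, branchesIL, im, ic, il, ir, iu, Pi.single_apply]
    by_cases hb : b ∈ branchesIL <;> simp [e, weightedRows, hb]

open Classical in
/-- A kernel vector of the matrix weighted by the L-proper trees gives a vector which the Jacobian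
matrix sends to a multiple of the unit vector of the charge equation. -/
theorem exists_jacobian_mulVec_eq_single [DecidableEq ι] [DecidableEq κ]
    {x : Var c l r u j → ℝ} (hx : N.IsEquilibrium B Q x)
    (hC : (N.C (vc x)).det ≠ 0) (hL : (N.L (il x)).det ≠ 0)
    (hR : (N.resistance (ir x)).IsDiag) {t : Branch c l r u j → ℝ} (ht0 : t ≠ 0)
    (ht : (weightedRows B Q (fun b => if b ∈ branchesVL then 0 else N.branchMR x b)
        (fun b => if b ∈ branchesIC then 0 else 1)).mulVec t = 0) :
    ∃ v : Var c l r u j → ℝ, v ≠ 0 ∧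
      (N.jacobian B Q x).mulVec v = v (.inl .charge) • Pi.single (.inl .charge) 1 := by
  -- Here `t` lists capacitor voltages and inductor currents in place of their conjugates, which are
  -- set to zero. The charge component is free because its column vanishes; it is set to the
  -- memristor current, which is the charge entry of the image.
  let v : Var c l r u j → ℝ := fun
    | .inl .charge => t .mem
    | .inl (.vcap k) => t (.cap k)
    | .inl (.iind k) => t (.ind k)
    | .inr .mem => t .mem
    | .inr (.cap _) => 0
    | .inr (.ind _) => 0
    | .inr (.res k) => t (.res k)
    | .inr (.vsrc k) => t (.vsrc k)
    | .inr (.isrc k) => t (.isrc k)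
  refine ⟨v, fun hv => ht0 ?_, ?_⟩
  · funext b
    cases b with
    | mem => exact congrFun hv (.inr .mem)
    | cap k => exact congrFun hv (.inl (.vcap k))
    | ind k => exact congrFun hv (.inl (.iind k))
    | res k => exact congrFun hv (.inr (.res k))
    | vsrc k => exact congrFun hv (.inr (.vsrc k))
    | isrc k => exact congrFun hv (.inr (.isrc k))
  have hic : ic v = 0 := rfl
  have hvl : vl v = 0 := rfl
  rw [jacobian_mulVec hx hC hL hR]
  funext s
  rcases s with (_ | k | k) | i | k
  · simp [linearDyn, im, v]
  · simp [linearDyn, hic]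
  · simp [linearDyn, hvl]
  · have e : N.linearVoltage x v = fun b =>
        (if b ∈ branchesVL then 0 else N.branchMR x b) * t b := by
      funext b
      cases b <;> simp [linearVoltage, branchesVL, im, vc, vl, ir, vj, v, branchMR]
    have h := congrFun ht (.inl i)
    simp only [Matrix.mulVec, dotProduct, weightedRows, Matrix.of_apply, Sum.elim_inl,
      mul_assoc] at h
    simpa [e, Matrix.mulVec, dotProduct] using h
  · have e : linearCurrent v = fun b => (if b ∈ branchesIC then 0 else 1) * t b := by
      funext b
      cases b <;> simp [linearCurrent, branchesIC, im, ic, il, ir, iu, v]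
    have h := congrFun ht (.inr k)
    simp only [Matrix.mulVec, dotProduct, weightedRows, Matrix.of_apply, Sum.elim_inr,
      mul_assoc] at h
    simpa [e, Matrix.mulVec, dotProduct] using h

open Polynomial in
theorem pencilDet_ne_zero {x : Var c l r u j → ℝ} (σ : ι ⊕ κ ≃ Branch c l r u j)
    (h : ((N.jacobian B Q x).toBlocks₂₂.submatrix σ.symm id).det ≠ 0) :
    N.pencilDet B Q σ x ≠ 0 := by
  have key := det_pencil_ne_zero (N.jacobian B Q x).toBlocks₁₁ (N.jacobian B Q x).toBlocks₁₂
    ((N.jacobian B Q x).toBlocks₂₁.submatrix σ.symm id) h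
  rw [pencilDet]
  convert key using 2
  ext1 s e
  rcases s with s | s <;> rcases e with e | e <;>
    simp [pencil, Matrix.toBlocks₁₁, Matrix.toBlocks₁₂, Matrix.toBlocks₂₁, Matrix.toBlocks₂₂]

open Polynomial in
-- At zero the pencil is `-F'`, and `σ` reorders only the algebraic rows, so the charge row and
-- column stay in place as `X_sq_dvd_det` requires.
theorem X_sq_dvd_pencilDet [DecidableEq ι] [DecidableEq κ] {x : Var c l r u j → ℝ}
    (hx : N.IsEquilibrium B Q x)
    (hC : (N.C (vc x)).det ≠ 0) (hL : (N.L (il x)).det ≠ 0)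
    (hR : (N.resistance (ir x)).IsDiag) (σ : ι ⊕ κ ≃ Branch c l r u j)
    {v : Var c l r u j → ℝ} (hv : v ≠ 0)
    (hJv : (N.jacobian B Q x).mulVec v = v (.inl .charge) • Pi.single (.inl .charge) 1) :
    (X : ℝ[X]) ^ 2 ∣ N.pencilDet B Q σ x := by
  set τ := Equiv.sumCongr (Equiv.refl (Dyn c l)) σ with hτ
  have hcol : ∀ s, N.jacobian B Q x s (.inl .charge) = 0 := by
    intro s
    have h := congrFun (jacobian_mulVec hx hC hL hR (Pi.single (.inl .charge) 1)) s
    rw [Matrix.mulVec_single_one] at h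
    refine Eq.trans h ?_
    have e1 : N.linearVoltage x (Pi.single (.inl .charge) 1) = 0 := by
      funext b
      cases b <;> simp [linearVoltage, im, vc, vl, ir, vj]
    have e2 : linearCurrent (Pi.single (.inl .charge) 1 : Var c l r u j → ℝ) = 0 := by
      funext b
      cases b <;> simp [linearCurrent, im, ic, il, ir, iu]
    have e3 : N.linearDyn x (Pi.single (.inl .charge) 1) = 0 := by
      funext b
      cases b <;> simp [linearDyn, im, ic, vl, Matrix.mulVec, dotProduct]
    rw [e1, e2, e3]
    rcases s with s | s | s <;> simp
  refine X_sq_dvd_det _ (.inl .charge) (fun s => ?_) hv ?_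
  · rcases s with s | s
    · simp [pencil, hcol, Matrix.one_apply, Pi.single_apply]
    · simp [pencil, hcol]
  · have h0 : (Matrix.reindex τ (Equiv.refl (Var c l r u j)) (N.pencil B Q x)).map
        (Polynomial.eval 0) = -(N.jacobian B Q x).submatrix τ.symm id := by
      ext s e
      simp [pencil]
    rw [h0, Matrix.neg_mulVec]
    congr 1
    funext s
    refine Eq.trans (congrFun hJv (τ.symm s)) ?_
    rcases s with s | s <;> simp [hτ, Pi.single_apply]

end Circuit

end Memristive

theorem proposition1 {V c l r u j ι κ : Type*}
    [Fintype V] [Fintype c] [Fintype l] [Fintype r] [Fintype u] [Fintype j]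
    [DecidableEq c] [DecidableEq l] [DecidableEq r] [DecidableEq u] [DecidableEq j]
    [Fintype ι] [Fintype κ]
    (N : Memristive.Circuit V c l r u j) (hconn : N.graph.IsConnected)
    (B : Matrix ι (Memristive.Branch c l r u j) ℝ) (hB : N.graph.IsReducedLoopMatrix B)
    (Q : Matrix κ (Memristive.Branch c l r u j) ℝ) (hQ : N.graph.IsReducedCutsetMatrix Q)
    (σ : ι ⊕ κ ≃ Memristive.Branch c l r u j)
    (x : Memristive.Var c l r u j → ℝ) (hx : N.IsEquilibrium B Q x)
    (hC : (N.C (Memristive.vc x)).det ≠ 0) (hL : (N.L (Memristive.il x)).det ≠ 0)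
    (hR : (N.resistance (Memristive.ir x)).IsDiag)
    (hVC : ¬ N.HasLoopIn Memristive.Circuit.branchesVC)
    (hIL : ¬ N.HasCutsetIn Memristive.Circuit.branchesIL)
    (hVL : ¬ N.HasLoopIn Memristive.Circuit.branchesVL)
    (hIC : ¬ N.HasCutsetIn Memristive.Circuit.branchesIC)
    (hproper : N.properTreeSum x ≠ 0)
    (hLproper : N.lProperTreeSum x = 0) :
    1 < N.zeroMultiplicity B Q σ x := by
  classical
  obtain ⟨K, hK, hP, hLP⟩ :=
    Memristive.Circuit.exists_det_weightedRows_eq_properTreeSum hconn hB hQ σ x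
  have h1 : N.pencilDet B Q σ x ≠ 0 := by
    apply Memristive.Circuit.pencilDet_ne_zero
    rw [Memristive.Circuit.toBlocks₂₂_jacobian hx hC hL hR, hP]
    exact mul_ne_zero hK hproper
  rw [hLproper, mul_zero] at hLP
  obtain ⟨t, ht0, ht⟩ := Matrix.exists_mulVec_eq_zero_iff.mpr hLP
  obtain ⟨v, hv, hJv⟩ :=
    Memristive.Circuit.exists_jacobian_mulVec_eq_single hx hC hL hR ht0
      (Memristive.mulVec_eq_zero_of_submatrix σ ht)
  have h2 := Memristive.Circuit.X_sq_dvd_pencilDet hx hC hL hR σ hv hJv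
  -- Regularity `h1` is essential here, as the root multiplicity of the zero polynomial is `0` by
  -- convention.
  rw [Memristive.Circuit.zeroMultiplicity, ← Nat.succ_le_iff, Polynomial.le_rootMultiplicity_iff h1]
  simpa using h2
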